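/- Let $K$ be a field of characteristic zero, and let $R=\bigoplus_{i\in\mathbb N}R_i$ be an $\mathbb N$-graded domain that is finitely generated as a $K$-algebra, with $R_0=K$. Let $D=D_{R|K}=\bigcup_n D^n_{R|K}$ be the ring of $K$-linear differential operators on $R$, with $D^n_{R|K}$ the operators of order at most $n$. Let $w$ be an integer such that $R$ is generated as a $K$-algebra by elements of degree less than $w$, and let $\mathcal B^\bullet$ be the Bernstein filtration of slope $w$ on $D$, that is, $$B^i=K\cdot\{\delta\in D \text{ homogeneous} : \deg(\delta)+w\operatorname{ord}(\delta)\le i\}.$$ Put $\operatorname{Dim}(\mathcal B^\bullet)=\inf\{t\in\mathbb R_{\ge0} : \lim_{n\to\infty}\dim_K(B^n)/n^t=0\}$ and, if $m=\operatorname{Dim}(\mathcal B^\bullet)$ is finite, $\operatorname{e}(\mathcal B^\bullet)=\limsup_{n\to\infty}\dim_K(B^n)/n^{m}$. Suppose that $$\operatorname{Dim}(\mathcal B^\bullet)=2\dim(R)\quad\text{and}\quad 0<\operatorname{e}(\mathcal B^\bullet)<\infty .$$ Suppose also that $D\otimes_K D^{\mathrm{op}}$ with the filtration $B^i_{\boxtimes}=B^i\otimes_K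 B^i$ is linearly simple: there is a constant $C$ such that for every $t\in\mathbb N$ and every nonzero $r\in B^t_\boxtimes$ one has $1\in B^{Ct}_\boxtimes\, r\, B^{Ct}_\boxtimes$ (the $K$-span of the products). Then every nonzero $f\in R$ has a nonzero sandwich Bernstein–Sato polynomial. Here the sandwich Bernstein–Sato polynomial of $f$ is the monic generator (zero if the ideal is zero) of the ideal of all $b(s)\in K[s]$ for which there are finitely many $\alpha_i(s),\beta_i(s)\in D[s]$ with $$\sum_i \alpha_i(n)\, f^{n+1}\,\beta_i(n)=b(n)\,f^n\quad\text{in } D \text{ for all } n\in\mathbb N,$$ where elements of $R$ act by multiplication and products are compositions of operators. -/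

import Mathlib

open scoped ENNReal NNReal TensorProduct Polynomial Topology

noncomputable section

namespace SandwichBS

/-! ### Rings of differential operators -/

section DiffOps

variable (K R : Type*) [CommRing K] [CommRing R] [Algebra K R]

/-- `diffOpOrder K R n` is `D^n_{R|K}`, the `K`-linear differential operators on `R` of order at
most `n`: `D^0` is the set of `R`-linear maps, and `δ ∈ D^{n+1}` when `[δ, r] ∈ D^n` for every
multiplication operator `r`. -/
def diffOpOrder : ℕ → Submodule K (Module.End K R)
  | 0 =>
    { carrier := {δ | ∀ r x : R, δ (r * x) = r * δ x}
      add_mem' := fun {a b} ha hb r x => by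
        simp only [LinearMap.add_apply, ha r x, hb r x, mul_add]
      zero_mem' := fun r x => by simp
      smul_mem' := fun c a ha r x => by
        simp only [LinearMap.smul_apply, ha r x, mul_smul_comm] }
  | n + 1 =>
    { carrier := {δ | ∀ r : R,
        δ * Algebra.lmul K R r - Algebra.lmul K R r * δ ∈ diffOpOrder n}
      add_mem' := fun {a b} ha hb r => by
        have h := (diffOpOrder n).add_mem (ha r) (hb r)
        have e : (a + b) * Algebra.lmul K R r - Algebra.lmul K R r * (a + b) =
            (a * Algebra.lmul K R r - Algebra.lmul K R r * a) +
            (b * Algebra.lmul K R r - Algebra.lmul K R r * b) := by noncomm_ring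
        rw [e]; exact h
      zero_mem' := fun r => by simp
      smul_mem' := fun c a ha r => by
        have h := (diffOpOrder n).smul_mem c (ha r)
        rw [smul_sub, ← smul_mul_assoc, ← mul_smul_comm] at h
        exact h }

variable {K R}

theorem mem_diffOpOrder_zero {δ : Module.End K R} :
    δ ∈ diffOpOrder K R 0 ↔ ∀ r x : R, δ (r * x) = r * δ x := Iff.rfl

theorem mem_diffOpOrder_succ {n : ℕ} {δ : Module.End K R} :
    δ ∈ diffOpOrder K R (n + 1) ↔
      ∀ r : R, δ * Algebra.lmul K R r - Algebra.lmul K R r * δ ∈ diffOpOrder K R n := Iff.rfl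

theorem lmul_mem_diffOpOrder_zero (r : R) : Algebra.lmul K R r ∈ diffOpOrder K R 0 := by
  intro s x
  simp only [Algebra.coe_lmul_eq_mul, LinearMap.mul_apply_apply]
  ring

theorem commutator_eq_zero {δ : Module.End K R} (h : δ ∈ diffOpOrder K R 0) (r : R) :
    δ * Algebra.lmul K R r - Algebra.lmul K R r * δ = 0 := by
  ext x
  simp [h r x]

theorem diffOpOrder_le_succ (n : ℕ) : diffOpOrder K R n ≤ diffOpOrder K R (n + 1) := by
  induction n with
  | zero =>
    intro δ h r
    rw [commutator_eq_zero h]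
    exact Submodule.zero_mem _
  | succ n ih => exact fun δ h r => ih (h r)

theorem diffOpOrder_mono : Monotone (diffOpOrder K R) :=
  monotone_nat_of_le_succ diffOpOrder_le_succ

theorem mul_mem_diffOpOrder {k m n : ℕ} (hk : m + n ≤ k) {α β : Module.End K R}
    (hα : α ∈ diffOpOrder K R m) (hβ : β ∈ diffOpOrder K R n) :
    α * β ∈ diffOpOrder K R k := by
  induction k generalizing m n α β with
  | zero =>
    obtain rfl : m = 0 := by omega
    obtain rfl : n = 0 := by omega
    intro r x
    simp [hβ r x, hα r (β x)]
  | succ k ih =>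
    intro r
    have e : α * β * Algebra.lmul K R r - Algebra.lmul K R r * (α * β) =
        α * (β * Algebra.lmul K R r - Algebra.lmul K R r * β) +
        (α * Algebra.lmul K R r - Algebra.lmul K R r * α) * β := by
      simp only [mul_sub, sub_mul, mul_assoc]
      abel
    rw [e]
    refine Submodule.add_mem _ ?_ ?_
    · rcases n with _ | n
      · rw [commutator_eq_zero hβ, mul_zero]; exact Submodule.zero_mem _
      · exact ih (by omega) hα (hβ r)
    · rcases m with _ | m
      · rw [commutator_eq_zero hα, zero_mul]; exact Submodule.zero_mem _
      · exact ih (by omega) (hα r) hβ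

variable (K R)

/-- The ring `D_{R|K}` of `K`-linear differential operators on `R`, a subalgebra of `End_K(R)`. -/
def diffOps : Subalgebra K (Module.End K R) where
  carrier := {δ | ∃ n, δ ∈ diffOpOrder K R n}
  mul_mem' := fun ⟨_, ha⟩ ⟨_, hb⟩ => ⟨_, mul_mem_diffOpOrder le_rfl ha hb⟩
  add_mem' := fun ⟨m, ha⟩ ⟨n, hb⟩ =>
    ⟨max m n, Submodule.add_mem _ (diffOpOrder_mono (le_max_left m n) ha)
      (diffOpOrder_mono (le_max_right m n) hb)⟩
  algebraMap_mem' := fun c => ⟨0, by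
    have h := lmul_mem_diffOpOrder_zero (K := K) (algebraMap K R c)
    rwa [AlgHom.commutes] at h⟩

variable {K R}

/-- The order of a differential operator: the least `n` with `δ ∈ D^n_{R|K}`. -/
def diffOrd (δ : diffOps K R) : ℕ := sInf {n | (δ : Module.End K R) ∈ diffOpOrder K R n}

variable (K)

/-- The identification of `R` with the operators of order zero: `r` acts by multiplication. -/
def mulOp : R →ₐ[K] diffOps K R :=
  (Algebra.lmul K R).codRestrict (diffOps K R) fun r => ⟨0, lmul_mem_diffOpOrder_zero r⟩

end DiffOps

/-! ### The Bernstein filtration -/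

section Bernstein

variable {K R : Type*} [Field K] [CommRing R] [Algebra K R]

/-- The graded piece `[R]_i` for an integer `i`, which is zero for negative `i`. -/
def gradedPiece (𝒜 : ℕ → Submodule K R) (i : ℤ) : Submodule K R :=
  if 0 ≤ i then 𝒜 i.toNat else ⊥

/-- `δ` is homogeneous of degree `d`: it maps `[R]_j` into `[R]_{j+d}` for all `j`. -/
def IsHomogeneousOp (𝒜 : ℕ → Submodule K R) (δ : diffOps K R) (d : ℤ) : Prop :=
  ∀ j : ℕ, ∀ x ∈ 𝒜 j, (δ : Module.End K R) x ∈ gradedPiece 𝒜 (j + d)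

/-- `w` is an admissible slope: `R` is generated as a `K`-algebra by elements of degree `< w`. -/
def IsSlope (𝒜 : ℕ → Submodule K R) (w : ℤ) : Prop :=
  Algebra.adjoin K {x : R | ∃ j : ℕ, (j : ℤ) < w ∧ x ∈ 𝒜 j} = ⊤

/-- The Bernstein filtration with slope `w` on `D_{R|K}`:
`B^i` is the `K`-span of the homogeneous `δ` with `deg δ + w * ord δ ≤ i`. -/
def bernsteinFiltration (𝒜 : ℕ → Submodule K R) (w : ℤ) (i : ℕ) : Submodule K (diffOps K R) :=
  Submodule.span K
    {δ | ∃ d : ℤ, IsHomogeneousOp 𝒜 δ d ∧ d + w * (diffOrd δ : ℤ) ≤ (i : ℤ)}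

end Bernstein

/-! ### Dimension, multiplicity and linear simplicity of filtrations -/

section Filtration

variable {K : Type*} [Field K]

/-- The `K`-dimension of the `n`-th term of a filtration, as an extended nonnegative real. -/
def filtRank {M : Type*} [AddCommMonoid M] [Module K M] (F : ℕ → Submodule K M) (n : ℕ) : ℝ≥0∞ :=
  ((Module.rank K (F n)).toENat : ℝ≥0∞)

/-- `Dim(F) = inf {t ≥ 0 | dim_K F^n / n^t → 0}`; it is `∞` if there is no such `t`. -/
def filtDim {M : Type*} [AddCommMonoid M] [Module K M] (F : ℕ → Submodule K M) : ℝ≥0∞ :=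
  ⨅ (t : ℝ≥0) (_ : Filter.Tendsto (fun n : ℕ => filtRank F n / (n : ℝ≥0∞) ^ (t : ℝ))
    Filter.atTop (𝓝 0)), (t : ℝ≥0∞)

/-- The multiplicity `limsup dim_K F^n / n^d`, `d = Dim(F)`, of a filtration of finite
dimension. -/
def filtMult {M : Type*} [AddCommMonoid M] [Module K M] (F : ℕ → Submodule K M) : ℝ≥0∞ :=
  Filter.limsup (fun n : ℕ => filtRank F n / (n : ℝ≥0∞) ^ (filtDim F).toReal) Filter.atTop

variable {A : Type*} [Semiring A] [Algebra K A]

/-- `(A, F)` is linearly simple: for some constant `C`, every nonzero `r ∈ F^t` satisfies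
`1 ∈ F^{Ct} r F^{Ct}` (the `K`-span of the products). -/
def IsLinearlySimple (F : ℕ → Submodule K A) : Prop :=
  ∃ C : ℕ, ∀ t : ℕ, ∀ r ∈ F t, r ≠ 0 →
    (1 : A) ∈ F (C * t) * Submodule.span K {r} * F (C * t)

/-- The filtration on `A ⊗_K A^op` induced by `F`, with `i`-th term `F^i ⊗_K F^i`. -/
def boxFiltration (F : ℕ → Submodule K A) (i : ℕ) : Submodule K (A ⊗[K] Aᵐᵒᵖ) :=
  Submodule.map₂ (TensorProduct.mk K A Aᵐᵒᵖ) (F i)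
    ((F i).map (MulOpposite.opLinearEquiv K : A ≃ₗ[K] Aᵐᵒᵖ).toLinearMap)

end Filtration

/-! ### Sandwich Bernstein–Sato polynomials -/

section SBS

variable {K R : Type*} [Field K] [CommRing R] [Algebra K R]

/-- `b(s)` satisfies a sandwich Bernstein–Sato equation for `f`: there are finitely many
`α_i(s), β_i(s) ∈ D_{R|K}[s]` with `∑ α_i(n) f^{n+1} β_i(n) = b(n) f^n` in `D_{R|K}` for all
`n ∈ ℕ`, products being compositions of operators. -/
def SatisfiesSBS (f : R) (b : K[X]) : Prop :=
  ∃ (m : ℕ) (α β : Fin m → (diffOps K R)[X]), ∀ n : ℕ,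
    ∑ i, (α i).eval (n : diffOps K R) * mulOp K f ^ (n + 1) * (β i).eval (n : diffOps K R) =
      b.eval (n : K) • mulOp K f ^ n

theorem eval_map_mul (k : K[X]) (p : (diffOps K R)[X]) (n : ℕ) :
    (k.map (algebraMap K (diffOps K R)) * p).eval (n : diffOps K R) =
      k.eval (n : K) • p.eval (n : diffOps K R) := by
  have h : (k.map (algebraMap K (diffOps K R))).eval (n : diffOps K R) =
      algebraMap K (diffOps K R) (k.eval (n : K)) := by
    rw [← Polynomial.eval_natCast_map]
  rw [Polynomial.eval, Polynomial.eval₂_mul_noncomm _ _ fun i => Nat.commute_cast _ n,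
    ← Polynomial.eval, ← Polynomial.eval, h, Algebra.smul_def]

variable (K) in
/-- The ideal of `K[s]` of all polynomials satisfying a sandwich Bernstein–Sato equation
for `f`. -/
def sbsIdeal (f : R) : Ideal K[X] where
  carrier := {b | SatisfiesSBS f b}
  zero_mem' := ⟨0, Fin.elim0, Fin.elim0, fun n => by simp⟩
  add_mem' := by
    rintro a b ⟨m, α, β, h⟩ ⟨m', α', β', h'⟩
    refine ⟨m + m', Fin.append α α', Fin.append β β', fun n => ?_⟩
    rw [Fin.sum_univ_add]
    simp only [Fin.append_left, Fin.append_right, h n, h' n, Polynomial.eval_add, add_smul]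
  smul_mem' := by
    rintro k b ⟨m, α, β, h⟩
    refine ⟨m, fun i => k.map (algebraMap K (diffOps K R)) * α i, β, fun n => ?_⟩
    simp only [eval_map_mul, smul_mul_assoc, ← Finset.smul_sum, h n, smul_smul, smul_eq_mul,
      Polynomial.eval_mul]

variable (K) in
/-- The sandwich Bernstein–Sato polynomial of `f`: the monic generator of `sbsIdeal K f`, or zero
if that ideal is zero. -/
def sbsPolynomial (f : R) : K[X] :=
  Submodule.IsPrincipal.generator (sbsIdeal K f) *
    Polynomial.C (Submodule.IsPrincipal.generator (sbsIdeal K f)).leadingCoeff⁻¹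

end SBS

end SandwichBS

end

noncomputable section

namespace SandwichBS

/-! ### Commutators with a multiplication operator -/

section DiffOps

variable {K R : Type*} [CommRing K] [CommRing R] [Algebra K R]

/-! The argument is Bernstein's, run over `D ⊗ Dᵒᵖ` instead of `D`. Let `L = K(s)` and let `M` be
the module of sequences in `D`, on which a polynomial `p` acts in the `n`-th place through `p(n)`,
with scalars extended to `L`. Multiplication from both sides makes `M` a module over `L ⊗ (D ⊗
Dᵒᵖ)`. The classes `u_j` of `n ↦ f^(n+j)` generate a descending chain of submodules `U_j`. If `u_j ∈
U_{j+1}` for some `j`, then clearing denominators and replacing `s` by `s - j` gives a sandwich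
equation with `b ≠ 0` (`exists_satisfiesSBS_of_mem_span`). It remains to see that the chain cannot
be strict at every step.

Lower bound: linear simplicity survives the extension of scalars to `L`
(`IsLinearlySimple.baseChange`), so the `n`-th term of the box filtration, of dimension `(dim
B^n)²`, acts faithfully on a suitable filtered piece of each nonzero `U_j / U_{j+1}`. Hence the next
filtered piece has dimension at least `dim B^n`, and `ℓ` strict steps force `ℓ * dim B^n` dimensions
inside `U_0` (`mul_le_finrank_of_strict_chain`).

Upper bound: operators in `B^i` have order at most `i`, so `a f^n = ∑ binom(n,k) f^(n-k) ad(f)^k(a)`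
stops at `k = i`, and `f^(n-i)` comes out on the left with coefficients polynomial in `n`. The
filtered pieces of `U_0` are therefore no larger than terms of `B` with index stretched linearly
(`finrank_map_toSpanSingleton_le`).

Positive finite multiplicity says that for infinitely many `n` such a stretch multiplies `dim B^n`
by a bounded factor only (`exists_finrank_lt_mul_finrank`). A large `ℓ` contradicts this. -/

instance : Ring (diffOps K R) := Subalgebra.toRing (diffOps K R)

theorem mem_diffOpOrder_diffOrd (δ : diffOps K R) :
    (δ : Module.End K R) ∈ diffOpOrder K R (diffOrd δ) :=
  Nat.sInf_mem (s := {n | (δ : Module.End K R) ∈ diffOpOrder K R n}) δ.2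

theorem diffOrd_le {δ : diffOps K R} {n : ℕ} (h : (δ : Module.End K R) ∈ diffOpOrder K R n) :
    diffOrd δ ≤ n :=
  Nat.sInf_le h

theorem diffOrd_mul_le (α β : diffOps K R) : diffOrd (α * β) ≤ diffOrd α + diffOrd β :=
  diffOrd_le (mul_mem_diffOpOrder le_rfl (mem_diffOpOrder_diffOrd α) (mem_diffOpOrder_diffOrd β))

theorem diffOrd_mulOp (r : R) : diffOrd (mulOp K r) = 0 :=
  Nat.le_zero.1 (diffOrd_le (lmul_mem_diffOpOrder_zero r))

/-- The commutator with multiplication by `f`, as a linear endomorphism of the ring of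
differential operators. -/
def adMul (f : R) : Module.End K (diffOps K R) :=
  LinearMap.mulRight K (mulOp K f) - LinearMap.mulLeft K (mulOp K f)

theorem adMul_apply (f : R) (δ : diffOps K R) :
    adMul f δ = δ * mulOp K f - mulOp K f * δ := rfl

theorem adMul_mem_of_mem_succ {f : R} {δ : diffOps K R} {n : ℕ}
    (h : (δ : Module.End K R) ∈ diffOpOrder K R (n + 1)) :
    (adMul f δ : Module.End K R) ∈ diffOpOrder K R n := h f

theorem adMul_eq_zero_of_mem_zero {f : R} {δ : diffOps K R}
    (h : (δ : Module.End K R) ∈ diffOpOrder K R 0) : adMul f δ = 0 :=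
  Subtype.ext (commutator_eq_zero h f)

theorem adMul_pow_eq_zero (f : R) {n k : ℕ} (hk : n < k) {δ : diffOps K R}
    (h : (δ : Module.End K R) ∈ diffOpOrder K R n) : (adMul f ^ k) δ = 0 := by
  induction n generalizing k δ with
  | zero =>
    obtain ⟨k, rfl⟩ := Nat.exists_eq_succ_of_ne_zero hk.ne'
    rw [Nat.succ_eq_add_one, pow_succ, Module.End.mul_apply, adMul_eq_zero_of_mem_zero h, map_zero]
  | succ n ih =>
    obtain ⟨k, rfl⟩ := Nat.exists_eq_succ_of_ne_zero (Nat.ne_zero_of_lt hk)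
    rw [Nat.succ_eq_add_one, pow_succ, Module.End.mul_apply]
    exact ih (by omega) (adMul_mem_of_mem_succ h)

/-- Right multiplication by `f` is the sum of `adMul f` and left multiplication by `f`, and these
two commute, so the binomial theorem applies to its `n`-th power. -/
theorem mul_mulOp_pow (f : R) (δ : diffOps K R) (n : ℕ) :
    δ * mulOp K f ^ n = ∑ k ∈ Finset.range (n + 1),
      (n.choose k : diffOps K R) * (mulOp K f ^ (n - k) * (adMul f ^ k) δ) := by
  have hc : Commute (adMul (K := K) f) (LinearMap.mulLeft K (mulOp K f)) := by
    refine LinearMap.ext fun x => ?_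
    simp only [Module.End.mul_apply, adMul_apply, LinearMap.mulLeft_apply, mul_sub, mul_assoc]
  have h1 : LinearMap.mulRight K (mulOp K f) =
      adMul f + LinearMap.mulLeft K (mulOp K f) :=
    LinearMap.ext fun x => (sub_add_cancel (x * mulOp K f) (mulOp K f * x)).symm
  have h2 : δ * mulOp K f ^ n = ((LinearMap.mulRight K (mulOp K f)) ^ n) δ := by
    rw [LinearMap.pow_mulRight, LinearMap.mulRight_apply]
  rw [h2, h1, hc.add_pow, LinearMap.sum_apply]
  refine Finset.sum_congr rfl fun k _ => ?_
  have h3 := (hc.pow_pow k (n - k)).eq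
  rw [h3, ← Nat.cast_comm, Module.End.mul_apply, Module.End.mul_apply, LinearMap.pow_mulLeft,
    LinearMap.mulLeft_apply, Module.End.natCast_apply, nsmul_eq_mul]

/-- For an operator of order at most `i` and `n ≥ i`, the power `f ^ (n - i)` can be moved to the
left of the operator. -/
theorem mul_mulOp_pow_of_mem (f : R) {δ : diffOps K R} {i n : ℕ} (hn : i ≤ n)
    (h : (δ : Module.End K R) ∈ diffOpOrder K R i) :
    δ * mulOp K f ^ n = ∑ k ∈ Finset.range (i + 1),
      (n.choose k : diffOps K R) *
        (mulOp K f ^ (n - i) * (mulOp K f ^ (i - k) * (adMul f ^ k) δ)) := by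
  rw [mul_mulOp_pow]
  symm
  refine Finset.sum_subset_zero_on_sdiff (Finset.range_subset_range.2 (by omega)) ?_ ?_
  · intro k hk
    have : i < k := by simp at hk; omega
    rw [adMul_pow_eq_zero f this h, mul_zero, mul_zero]
  · intro k hk
    have : k ≤ i := by simp at hk; omega
    rw [← mul_assoc (mulOp K f ^ (n - i)), ← pow_add]
    congr 4
    omega

end DiffOps

/-! ### The Bernstein filtration: products and bounds on the order -/

section Bernstein

variable {K R : Type*} [Field K] [CommRing R] [Algebra K R] {𝒜 : ℕ → Submodule K R}

theorem IsHomogeneousOp.mul {α β : diffOps K R} {a b : ℤ} (hα : IsHomogeneousOp 𝒜 α a)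
    (hβ : IsHomogeneousOp 𝒜 β b) : IsHomogeneousOp 𝒜 (α * β) (a + b) := by
  intro j x hx
  have h := hβ j x hx
  rw [MulMemClass.coe_mul, Module.End.mul_apply]
  by_cases hj : 0 ≤ (j : ℤ) + b
  · rw [gradedPiece, if_pos hj] at h
    have h' := hα _ _ h
    rw [Int.toNat_of_nonneg hj] at h'
    rwa [show (j : ℤ) + (a + b) = j + b + a by ring]
  · rw [gradedPiece, if_neg hj, Submodule.mem_bot] at h
    rw [h, map_zero]
    exact Submodule.zero_mem _

theorem IsHomogeneousOp.sub {α β : diffOps K R} {a : ℤ} (hα : IsHomogeneousOp 𝒜 α a)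
    (hβ : IsHomogeneousOp 𝒜 β a) : IsHomogeneousOp 𝒜 (α - β) a := fun j x hx =>
  Submodule.sub_mem _ (hα j x hx) (hβ j x hx)

theorem isHomogeneousOp_mulOp [GradedAlgebra 𝒜] {j : ℕ} {r : R} (hr : r ∈ 𝒜 j) :
    IsHomogeneousOp 𝒜 (mulOp K r) j := by
  intro k x hx
  have h : r * x ∈ 𝒜 (j + k) := SetLike.mul_mem_graded hr hx
  rw [gradedPiece, if_pos (by omega), show ((k : ℤ) + j).toNat = j + k by omega]
  exact h

theorem bernsteinFiltration_mono (w : ℤ) : Monotone (bernsteinFiltration (K := K) 𝒜 w) :=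
  fun _ _ hij => Submodule.span_mono fun _ ⟨d, h1, h2⟩ => ⟨d, h1, h2.trans (by exact_mod_cast hij)⟩

theorem mulOp_mem_bernsteinFiltration [GradedAlgebra 𝒜] (w : ℤ) {j : ℕ} {r : R} (hr : r ∈ 𝒜 j) :
    mulOp K r ∈ bernsteinFiltration 𝒜 w j :=
  Submodule.subset_span ⟨j, isHomogeneousOp_mulOp hr, by simp [diffOrd_mulOp]⟩

theorem one_mem_bernsteinFiltration [GradedAlgebra 𝒜] (w : ℤ) (i : ℕ) :
    (1 : diffOps K R) ∈ bernsteinFiltration 𝒜 w i := by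
  rw [← map_one (mulOp K)]
  exact bernsteinFiltration_mono w (Nat.zero_le i)
    (mulOp_mem_bernsteinFiltration w SetLike.GradedOne.one_mem)

theorem exists_mulOp_mem_bernsteinFiltration [GradedAlgebra 𝒜] (w : ℤ) (f : R) :
    ∃ e, mulOp K f ∈ bernsteinFiltration 𝒜 w e := by
  classical
  refine ⟨(DirectSum.decompose 𝒜 f).support.sup id, ?_⟩
  have h : ∑ j ∈ (DirectSum.decompose 𝒜 f).support,
      mulOp K (DirectSum.decompose 𝒜 f j : R) = mulOp K f := by
    rw [← map_sum, DirectSum.sum_support_decompose 𝒜 f]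
  rw [← h]
  refine Submodule.sum_mem _ fun j hj => ?_
  exact bernsteinFiltration_mono w (Finset.le_sup (f := id) hj)
    (mulOp_mem_bernsteinFiltration w (SetLike.coe_mem _))

theorem bernsteinFiltration_mul_le {w : ℤ} (hw : 0 ≤ w) (i j : ℕ) :
    bernsteinFiltration (K := K) 𝒜 w i * bernsteinFiltration 𝒜 w j ≤
      bernsteinFiltration 𝒜 w (i + j) := by
  rw [bernsteinFiltration, bernsteinFiltration, Submodule.span_mul_span, Submodule.span_le]
  rintro _ ⟨α, ⟨a, hα, ha⟩, β, ⟨b, hβ, hb⟩, rfl⟩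
  refine Submodule.subset_span ⟨a + b, hα.mul hβ, ?_⟩
  have h : (diffOrd (α * β) : ℤ) ≤ diffOrd α + diffOrd β := by exact_mod_cast diffOrd_mul_le α β
  push_cast
  nlinarith [mul_le_mul_of_nonneg_left h hw]

/-- Commuting with a set of algebra generators is enough for an operator to have order zero. -/
theorem mem_diffOpOrder_zero_of_adjoin {s : Set R} (hs : Algebra.adjoin K s = ⊤)
    {δ : diffOps K R} (h : ∀ r ∈ s, adMul r δ = 0) :
    (δ : Module.End K R) ∈ diffOpOrder K R 0 := by
  have key : ∀ r : R, δ * mulOp K r = mulOp K r * δ := by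
    intro r
    have hr : r ∈ Algebra.adjoin K s := hs ▸ Algebra.mem_top
    induction hr using Algebra.adjoin_induction with
    | mem x hx => exact sub_eq_zero.1 (h x hx)
    | algebraMap c =>
      rw [AlgHom.commutes, Algebra.commutes]
    | add x y _ _ hx hy => rw [map_add, mul_add, add_mul, hx, hy]
    | mul x y _ _ hx hy => rw [map_mul, ← mul_assoc, hx, mul_assoc, hy, mul_assoc]
  intro r x
  exact congrArg (fun φ : diffOps K R => (φ : Module.End K R) x) (key r)

/-- Each commutator with a generator of degree `j ≤ w - 1` lowers the order bound by one and raises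
the degree by `j`. After at most `n` nonzero commutators a nonzero operator of order zero is left,
whose degree cannot be negative. -/
theorem neg_mul_le_degree [GradedAlgebra 𝒜] {w : ℤ} (hw : IsSlope 𝒜 w) (hw1 : 1 ≤ w) {n : ℕ}
    {d : ℤ} {δ : diffOps K R} (hδ : (δ : Module.End K R) ∈ diffOpOrder K R n)
    (hd : IsHomogeneousOp 𝒜 δ d) (h0 : δ ≠ 0) : -(n * (w - 1)) ≤ d := by
  have zero_case : ∀ {d : ℤ} {δ : diffOps K R}, (δ : Module.End K R) ∈ diffOpOrder K R 0 →
      IsHomogeneousOp 𝒜 δ d → δ ≠ 0 → 0 ≤ d := by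
    intro d δ hδ hd h0
    -- An operator of order zero is multiplication by its value at `1`, and a negative degree forces
    -- that value to vanish.
    by_contra hneg
    have h1 := hd 0 1 SetLike.GradedOne.one_mem
    rw [gradedPiece, if_neg (by simpa using hneg), Submodule.mem_bot] at h1
    refine h0 (Subtype.ext (LinearMap.ext fun x => ?_))
    have h2 := hδ x 1
    rw [mul_one, h1, mul_zero] at h2
    exact h2
  induction n generalizing d δ with
  | zero => simpa using zero_case hδ hd h0
  | succ n ih =>
    have hnn : 0 ≤ ((n + 1 : ℕ) : ℤ) * (w - 1) := by
      have : 0 ≤ w - 1 := by omega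
      positivity
    by_cases hz : ∀ r ∈ {x : R | ∃ j : ℕ, (j : ℤ) < w ∧ x ∈ 𝒜 j}, adMul r δ = 0
    · have := zero_case (mem_diffOpOrder_zero_of_adjoin hw hz) hd h0
      omega
    · push Not at hz
      obtain ⟨r, ⟨j, hj, hr⟩, hne⟩ := hz
      have hh : IsHomogeneousOp 𝒜 (adMul r δ) (d + j) := by
        refine (hd.mul (isHomogeneousOp_mulOp hr)).sub ?_
        rw [add_comm]
        exact (isHomogeneousOp_mulOp hr).mul hd
      have := ih (adMul_mem_of_mem_succ hδ) hh hne
      push_cast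
      linarith

/-- For a nonzero homogeneous generator, adding `d ≥ -ord * (w - 1)` to `d + w * ord ≤ i` leaves
`ord ≤ i`. The strict bound `< w` on the degrees of algebra generators is what makes this work. -/
theorem mem_diffOpOrder_of_mem_bernsteinFiltration [GradedAlgebra 𝒜] {w : ℤ} (hw : IsSlope 𝒜 w)
    (hw1 : 1 ≤ w) {i : ℕ} {δ : diffOps K R} (hδ : δ ∈ bernsteinFiltration 𝒜 w i) :
    (δ : Module.End K R) ∈ diffOpOrder K R i := by
  have h : bernsteinFiltration 𝒜 w i ≤
      (diffOpOrder K R i).comap (diffOps K R).val.toLinearMap := by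
    refine Submodule.span_le.2 ?_
    rintro δ ⟨d, hd, hi⟩
    rcases eq_or_ne δ 0 with rfl | h0
    · exact Submodule.zero_mem _
    · have hδ := mem_diffOpOrder_diffOrd δ
      have := neg_mul_le_degree hw hw1 hδ hd h0
      have h' : diffOrd δ ≤ i := by
        have : (diffOrd δ : ℤ) ≤ i := by linarith
        exact_mod_cast this
      exact diffOpOrder_mono h' hδ
  exact h hδ

theorem adMul_pow_mem_bernsteinFiltration {w : ℤ} (hw : 0 ≤ w) {f : R} {e : ℕ}
    (he : mulOp K f ∈ bernsteinFiltration 𝒜 w e) (k : ℕ) {i : ℕ} {δ : diffOps K R}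
    (hδ : δ ∈ bernsteinFiltration 𝒜 w i) :
    (adMul f ^ k) δ ∈ bernsteinFiltration 𝒜 w (i + k * e) := by
  induction k with
  | zero => simpa using hδ
  | succ k ih =>
    rw [pow_succ', Module.End.mul_apply, adMul_apply]
    refine Submodule.sub_mem _ ?_ ?_
    · rw [show i + (k + 1) * e = i + k * e + e by ring]
      exact bernsteinFiltration_mul_le hw _ _ (Submodule.mul_mem_mul ih he)
    · rw [show i + (k + 1) * e = e + (i + k * e) by ring]
      exact bernsteinFiltration_mul_le hw _ _ (Submodule.mul_mem_mul he ih)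

theorem mulOp_pow_mem_bernsteinFiltration [GradedAlgebra 𝒜] {w : ℤ} (hw : 0 ≤ w) {f : R} {e : ℕ}
    (he : mulOp K f ∈ bernsteinFiltration 𝒜 w e) (k : ℕ) :
    mulOp K f ^ k ∈ bernsteinFiltration 𝒜 w (k * e) := by
  induction k with
  | zero => rw [pow_zero]; exact one_mem_bernsteinFiltration w _
  | succ k ih =>
    rw [pow_succ, add_mul, one_mul]
    exact bernsteinFiltration_mul_le hw _ _ (Submodule.mul_mem_mul ih he)

end Bernstein

/-! ### From a sandwich equation to the sandwich polynomial -/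

section SBS

variable {K R : Type*} [Field K] [CommRing R] [Algebra K R]

theorem sbsPolynomial_ne_zero {f : R} {b : K[X]} (hb : b ≠ 0) (h : SatisfiesSBS f b) :
    sbsPolynomial K f ≠ 0 := by
  have hg : Submodule.IsPrincipal.generator (sbsIdeal K f) ≠ 0 := by
    intro h0
    rw [← Submodule.IsPrincipal.eq_bot_iff_generator_eq_zero] at h0
    have : b ∈ sbsIdeal K f := h
    rw [h0] at this
    exact hb this
  exact mul_ne_zero hg (Polynomial.C_ne_zero.2 (inv_ne_zero (Polynomial.leadingCoeff_ne_zero.2 hg)))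

theorem satisfiesSBS_one_of_isUnit {f : R} (hf : IsUnit f) : SatisfiesSBS f (1 : K[X]) := by
  obtain ⟨g, hg⟩ := hf.exists_left_inv
  refine ⟨1, fun _ => Polynomial.C (mulOp K g), fun _ => 1, fun n => ?_⟩
  simp only [Finset.univ_unique, Finset.sum_singleton, Polynomial.eval_C, Polynomial.eval_one,
    mul_one, one_smul]
  rw [pow_succ', ← mul_assoc, ← map_mul, hg, map_one, one_mul]

end SBS

/-! ### Linear simplicity over the field of rational functions -/

section BaseChange

variable {K : Type*} [Field K]

/-- Linear simplicity of a filtration by finite-dimensional subspaces is preserved by the extension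
of scalars from an infinite field to its field of rational functions. -/
theorem IsLinearlySimple.baseChange [Infinite K] (L : Type*) [Field L] [Algebra K[X] L]
    [IsFractionRing K[X] L] [Algebra K L] [IsScalarTower K K[X] L] {E : Type*} [Ring E]
    [Algebra K E] {F : ℕ → Submodule K E} (hfin : ∀ i, Module.Finite K (F i))
    (h_one : ∀ i, 1 ∈ F i) (hmul : ∀ i j, F i * F j ≤ F (i + j)) (h : IsLinearlySimple F) :
    IsLinearlySimple fun i => (F i).baseChange L := by
  obtain ⟨C, hC⟩ := h
  refine ⟨C, fun t r hr h0 => ?_⟩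
  by_contra hn
  -- Failure over `L` is witnessed by a functional that kills all products but not `1`. Once `r` and
  -- this functional have polynomial coordinates, evaluation at a point of `K` gives a failure over
  -- `K` with the same constant `C`.
  obtain ⟨φ, hφ1, hφ⟩ := Submodule.exists_le_ker_of_notMem hn
  have hφ0 : ∀ a ∈ F (C * t), ∀ b ∈ F (C * t), φ ((1 ⊗ₜ a) * r * (1 ⊗ₜ b)) = 0 := fun a ha b hb =>
    hφ (Submodule.mul_mem_mul (Submodule.mul_mem_mul (Submodule.tmul_mem_baseChange_of_mem 1 ha)
      (Submodule.mem_span_singleton_self r)) (Submodule.tmul_mem_baseChange_of_mem 1 hb))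
  -- coordinates of `r`, with denominators cleared
  have := hfin t
  let b := Module.finBasis K (F t)
  obtain ⟨x, rfl⟩ : ∃ x : L ⊗[K] F t, ((F t).toBaseChange L x : L ⊗[K] E) = r := by
    obtain ⟨x, hx⟩ := (F t).toBaseChange_surjective L ⟨r, hr⟩
    exact ⟨x, congrArg Subtype.val hx⟩
  have hx0 : x ≠ 0 := by rintro rfl; simp at h0
  set c : Fin (Module.finrank K (F t)) → L := fun k => (b.baseChange L).repr x k with hc
  have hx : ((F t).toBaseChange L x : L ⊗[K] E) = ∑ k, c k • (1 ⊗ₜ (b k : E)) := by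
    conv_lhs => rw [← (b.baseChange L).sum_repr x]
    simp [hc]
  obtain ⟨k₀, hk₀⟩ : ∃ k, c k ≠ 0 := by
    by_contra! hall
    exact hx0 ((b.baseChange L).ext_elem fun k => by simpa using hall k)
  obtain ⟨p, hp⟩ := IsLocalization.exist_integer_multiples_of_finite (nonZeroDivisors K[X]) c
  choose c' hc' using hp
  have hp0 : algebraMap K[X] L p ≠ 0 := IsFractionRing.to_map_ne_zero_of_mem_nonZeroDivisors p.2
  -- the functional `φ`, with denominators cleared
  set W := F (C * t + t + C * t) with hW
  have := hfin (C * t + t + C * t)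
  let β := Module.finBasis K W
  obtain ⟨q, hq⟩ := IsLocalization.exist_integer_multiples_of_finite (nonZeroDivisors K[X])
    (fun k => φ (1 ⊗ₜ (β k : E)))
  choose v hv using hq
  have hq0 : algebraMap K[X] L q ≠ 0 := IsFractionRing.to_map_ne_zero_of_mem_nonZeroDivisors q.2
  obtain ⟨ψ, hψ⟩ := LinearMap.exists_extend (β.constr K v)
  have hψφ : ∀ y ∈ W, algebraMap K[X] L (ψ y) = algebraMap K[X] L q * φ (1 ⊗ₜ y) := by
    have : (IsScalarTower.toAlgHom K K[X] L).toLinearMap ∘ₗ ψ ∘ₗ W.subtype =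
        LinearMap.mulLeft K (algebraMap K[X] L q) ∘ₗ φ.restrictScalars K ∘ₗ
          TensorProduct.mk K L E 1 ∘ₗ W.subtype := by
      rw [hψ]
      refine β.ext fun k => ?_
      simp [hv, Algebra.smul_def]
    exact fun y hy => congrArg (fun ξ => ξ ⟨y, hy⟩) this
  have hWmul : ∀ a ∈ F (C * t), ∀ y ∈ F t, ∀ a' ∈ F (C * t), a * y * a' ∈ W :=
    fun a ha y hy a' ha' => hmul _ _ (Submodule.mul_mem_mul
      (hmul _ _ (Submodule.mul_mem_mul ha hy)) ha')
  have hzero : ∀ a ∈ F (C * t), ∀ a' ∈ F (C * t), ∑ k, c' k * ψ (a * b k * a') = 0 := by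
    intro a ha a' ha'
    refine IsFractionRing.injective K[X] L ?_
    have h1 := hφ0 a ha a' ha'
    rw [hx, Finset.mul_sum, Finset.sum_mul, map_sum] at h1
    rw [map_sum, map_zero, ← mul_zero (algebraMap K[X] L p * algebraMap K[X] L q), ← h1,
      Finset.mul_sum]
    refine Finset.sum_congr rfl fun k _ => ?_
    rw [map_mul, hψφ _ (hWmul a ha _ (b k).2 a' ha'), hc', Algebra.smul_def (p : K[X]) (c k),
      mul_smul_comm, smul_mul_assoc, map_smul, Algebra.TensorProduct.tmul_mul_tmul,
      Algebra.TensorProduct.tmul_mul_tmul, one_mul, one_mul, smul_eq_mul]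
    ring
  -- specialization
  have hne : ψ 1 * c' k₀ ≠ 0 := by
    refine mul_ne_zero (fun h => ?_) (fun h => ?_)
    · have h1 := hψφ 1 (h_one _)
      rw [h, map_zero] at h1
      exact mul_ne_zero hq0 hφ1 h1.symm
    · have h1 := hc' k₀
      rw [h, map_zero, Algebra.smul_def] at h1
      exact mul_ne_zero hp0 hk₀ h1.symm
  -- `K` is infinite, so one point avoids the zeros of both polynomials: there the functional still
  -- detects `1` and the specialized element stays nonzero.
  obtain ⟨z, hz⟩ : ∃ z, (ψ 1 * c' k₀).eval z ≠ 0 := by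
    by_contra! hall
    exact hne (Polynomial.funext fun z => by simpa using hall z)
  rw [Polynomial.eval_mul] at hz
  set s : F t := ∑ k, (c' k).eval z • b k with hs
  have hs0 : (s : E) ≠ 0 := by
    intro h
    have h' : s = 0 := Subtype.ext h
    have := Fintype.linearIndependent_iff.1 b.linearIndependent _ (hs.symm.trans h') k₀
    exact right_ne_zero_of_mul hz this
  have hker : F (C * t) * Submodule.span K {(s : E)} * F (C * t) ≤
      LinearMap.ker (Polynomial.leval z ∘ₗ ψ) := by
    rw [Submodule.mul_le]
    intro y hy a' ha'
    induction hy using Submodule.mul_induction_on' with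
    | add y _ y' _ h h' => rw [add_mul]; exact Submodule.add_mem _ h h'
    | mem_mul_mem a ha y hy =>
      obtain ⟨κ, rfl⟩ := Submodule.mem_span_singleton.1 hy
      rw [mul_smul_comm, smul_mul_assoc]
      refine Submodule.smul_mem _ _ ?_
      rw [LinearMap.mem_ker, hs]
      have h1 := congrArg (Polynomial.eval z) (hzero a ha a' ha')
      rw [Polynomial.eval_finsetSum, Polynomial.eval_zero] at h1
      rw [← h1]
      simp [Finset.mul_sum, Finset.sum_mul, Polynomial.leval_apply]
  have h1 := hker (hC t s s.2 hs0)
  exact left_ne_zero_of_mul hz h1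

end BaseChange

/-! ### Bernstein's inequality and chains of submodules -/

section Inequality

variable {L A M : Type*} [Field L] [Ring A] [Algebra L A] [AddCommGroup M] [Module L M]
  [Module A M] [IsScalarTower L A M] {F : ℕ → Submodule L A}

/-- Bernstein's inequality: `F n` acts faithfully on a subspace that contains `F (C * n) • u`. -/
theorem finrank_le_finrank_mul_finrank {p q : Submodule L A}
    (h : ∀ r ∈ p, r ≠ 0 → (1 : A) ∈ q * Submodule.span L {r} * q) {u : M} (hu : u ≠ 0)
    (V W : Submodule L M) [FiniteDimensional L V] [FiniteDimensional L W]
    (hV : ∀ a ∈ q, a • u ∈ V) (hW : ∀ a ∈ p, ∀ v ∈ V, a • v ∈ W) :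
    Module.finrank L p ≤ Module.finrank L V * Module.finrank L W := by
  let Φ : p →ₗ[L] V →ₗ[L] W :=
    LinearMap.mk₂ L (fun a v => ⟨(a : A) • (v : M), hW a a.2 v v.2⟩)
      (fun a b v => Subtype.ext (add_smul _ _ _)) (fun c a v => Subtype.ext (smul_assoc _ _ _))
      (fun a v v' => Subtype.ext (smul_add _ _ _))
      (fun c a v => Subtype.ext (smul_algebra_smul_comm _ _ _))
  have hΦ : Function.Injective Φ := by
    rw [injective_iff_map_eq_zero]
    intro r hr
    by_contra hr0
    have hr0' : (r : A) ≠ 0 := fun h0 => hr0 (Subtype.ext h0)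
    have hkill : ∀ v ∈ V, (r : A) • v = 0 := fun v hv =>
      congrArg (fun φ : V →ₗ[L] W => (φ ⟨v, hv⟩ : M)) hr
    -- If `r` kills `V`, which contains `q • u`, then `q r q` kills `u`; as `1 ∈ q r q`, this gives
    -- `u = 0`.
    have hle : q * Submodule.span L {(r : A)} * q ≤
        LinearMap.ker ((LinearMap.toSpanSingleton A M u).restrictScalars L) := by
      rw [Submodule.mul_le]
      intro y hy a ha
      rw [LinearMap.mem_ker]
      simp only [LinearMap.coe_restrictScalars, LinearMap.toSpanSingleton_apply]
      induction hy using Submodule.mul_induction_on' with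
      | add y _ y' _ h h' => rw [add_mul, add_smul, h, h', add_zero]
      | mem_mul_mem b hb y hy =>
        obtain ⟨κ, rfl⟩ := Submodule.mem_span_singleton.1 hy
        rw [mul_smul_comm, smul_mul_assoc, smul_assoc, mul_smul, mul_smul, hkill _ (hV a ha),
          smul_zero, smul_zero]
    have h1 := hle (h r r.2 hr0')
    rw [LinearMap.mem_ker] at h1
    simp only [LinearMap.coe_restrictScalars, LinearMap.toSpanSingleton_apply, one_smul] at h1
    exact hu h1
  calc Module.finrank L p ≤ Module.finrank L (V →ₗ[L] W) :=
        LinearMap.finrank_le_finrank_of_injective hΦ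
    _ = _ := Module.finrank_linearMap L L V W

theorem finrank_map_add_finrank_inf_ker {M' : Type*} [AddCommGroup M'] [Module L M']
    (g : M →ₗ[L] M') (P : Submodule L M) [FiniteDimensional L P] :
    Module.finrank L (P.map g) + Module.finrank L (P ⊓ LinearMap.ker g : Submodule L M) =
      Module.finrank L P := by
  have h := LinearMap.finrank_range_add_finrank_ker (g.domRestrict P)
  rw [LinearMap.range_domRestrict, LinearMap.ker_domRestrict] at h
  rw [← h, ← Submodule.map_comap_subtype, ← Submodule.finrank_map_subtype_eq]

/-- In a module over a linearly simple filtered algebra, the length of a strict chain of submodules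
is bounded in terms of the dimensions of the filtrations. -/
theorem mul_le_finrank_of_strict_chain {C : ℕ}
    (h : ∀ t : ℕ, ∀ r ∈ F t, r ≠ 0 → (1 : A) ∈ F (C * t) * Submodule.span L {r} * F (C * t))
    {G : ℕ → Submodule L M} (hG : Monotone G) (hGfin : ∀ i, FiniteDimensional L (G i))
    (hFG : ∀ i j, ∀ a ∈ F i, ∀ x ∈ G j, a • x ∈ G (i + j))
    {U : ℕ → Submodule A M} (hU : Antitone U) {u : ℕ → M} {ℓ i₀ : ℕ}
    (hu : ∀ j < ℓ, u j ∈ U j) (hu' : ∀ j < ℓ, u j ∉ U (j + 1)) (huG : ∀ j < ℓ, u j ∈ G i₀)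
    {n b : ℕ} (hb : b * b ≤ Module.finrank L (F n)) :
    ℓ * b ≤ Module.finrank L (G (n + (C * n + i₀))) := by
  set P : ℕ → Submodule L M := fun j => G (n + (C * n + i₀)) ⊓ (U j).restrictScalars L with hP
  have hPfin : ∀ j, FiniteDimensional L (P j) := fun j =>
    Submodule.finiteDimensional_of_le (inf_le_left : P j ≤ G (n + (C * n + i₀)))
  have step : ∀ j < ℓ, b + Module.finrank L (P (j + 1)) ≤ Module.finrank L (P j) := by
    intro j hj
    set g := (U (j + 1)).mkQ.restrictScalars L with hg
    -- Thus the loss of dimension from `P j` to `P (j + 1)` is exactly the dimension of the image of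
    -- `P j` in the quotient by `U (j + 1)`.
    have hker : P j ⊓ LinearMap.ker g = P (j + 1) := by
      have hk : LinearMap.ker g = (U (j + 1)).restrictScalars L := by
        ext x
        simp [hg]
      rw [hk, hP]
      dsimp only
      have hle : (U (j + 1)).restrictScalars L ≤ (U j).restrictScalars L :=
        fun x hx => hU (Nat.le_succ j) hx
      rw [inf_assoc, inf_eq_right.2 hle]
    rw [← finrank_map_add_finrank_inf_ker g (P j), hker]
    refine Nat.add_le_add_right ?_ _
    set V := (G (C * n + i₀) ⊓ (U j).restrictScalars L).map g with hV
    have := hGfin (C * n + i₀)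
    have hVW : V ≤ (P j).map g :=
      Submodule.map_mono (inf_le_inf_right _ (hG (Nat.le_add_left _ _)))
    have hne : g (u j) ≠ 0 := fun h0 => hu' j hj ((Submodule.Quotient.mk_eq_zero _).1 h0)
    have key := finrank_le_finrank_mul_finrank (h n) hne V ((P j).map g) ?_ ?_
    -- Since `V` lies in the image of `P j`, the inequality `b² ≤ dim V * dim W` bounds `b` by the
    -- dimension of that image.
    · have hle := Submodule.finrank_mono hVW
      by_contra! hlt
      have := Nat.mul_self_lt_mul_self hlt
      have := Nat.mul_le_mul_right (Module.finrank L ((P j).map g)) hle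
      omega
    · intro a ha
      exact ⟨a • u j, ⟨hFG _ _ a ha _ (huG j hj), (U j).smul_mem a (hu j hj)⟩, rfl⟩
    · rintro a ha _ ⟨v, ⟨hv, hv'⟩, rfl⟩
      exact ⟨a • v, ⟨hFG _ _ a ha _ hv, (U j).smul_mem a hv'⟩, rfl⟩
  have sum : ∀ k ≤ ℓ, k * b + Module.finrank L (P k) ≤ Module.finrank L (P 0) := by
    intro k hk
    induction k with
    | zero => simp
    | succ k ih =>
      have := step k hk
      have := ih (by omega)
      rw [add_mul, one_mul]
      omega
  have := hGfin (n + (C * n + i₀))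
  calc ℓ * b ≤ Module.finrank L (P 0) := (Nat.le_add_right _ _).trans (sum ℓ le_rfl)
    _ ≤ _ := Submodule.finrank_mono inf_le_left

end Inequality

/-! ### The induced filtration on `D ⊗ Dᵒᵖ` -/

section BoxFiltration

variable {K A : Type*} [Field K] [Ring A] [Algebra K A] {F : ℕ → Submodule K A}

theorem tmul_mem_boxFiltration {i : ℕ} {a b : A} (ha : a ∈ F i) (hb : b ∈ F i) :
    a ⊗ₜ[K] MulOpposite.op b ∈ boxFiltration F i :=
  Submodule.apply_mem_map₂ _ ha (Submodule.mem_map_of_mem hb)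

theorem boxFiltration_eq_span (i : ℕ) : boxFiltration F i =
    Submodule.span K {x | ∃ a ∈ F i, ∃ b ∈ F i, a ⊗ₜ[K] MulOpposite.op b = x} := by
  rw [boxFiltration, Submodule.map₂_eq_span_image2]
  congr 1
  ext x
  simp [Set.image2]

theorem one_mem_boxFiltration {i : ℕ} (h : 1 ∈ F i) : 1 ∈ boxFiltration F i :=
  tmul_mem_boxFiltration h h

theorem boxFiltration_mul_le (hmul : ∀ i j, F i * F j ≤ F (i + j))
    (i j : ℕ) : boxFiltration F i * boxFiltration F j ≤ boxFiltration F (i + j) := by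
  rw [boxFiltration_eq_span, boxFiltration_eq_span, Submodule.span_mul_span, Submodule.span_le]
  rintro _ ⟨_, ⟨a, ha, b, hb, rfl⟩, _, ⟨a', ha', b', hb', rfl⟩, rfl⟩
  dsimp only
  rw [Algebra.TensorProduct.tmul_mul_tmul, ← MulOpposite.op_mul]
  exact tmul_mem_boxFiltration (hmul i j (Submodule.mul_mem_mul ha ha'))
    (add_comm j i ▸ hmul j i (Submodule.mul_mem_mul hb' hb))

theorem finite_boxFiltration (hfin : ∀ i, FiniteDimensional K (F i)) (i : ℕ) :
    FiniteDimensional K (boxFiltration F i) := by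
  have := hfin i
  have : FiniteDimensional K
      ((F i).map (MulOpposite.opLinearEquiv K : A ≃ₗ[K] Aᵐᵒᵖ).toLinearMap) := inferInstance
  rw [boxFiltration, ← TensorProduct.range_mapIncl]
  infer_instance

theorem finrank_boxFiltration (i : ℕ) : Module.finrank K (boxFiltration F i) =
    Module.finrank K (F i) * Module.finrank K (F i) := by
  rw [boxFiltration, ← TensorProduct.range_mapIncl, LinearMap.finrank_range_of_inj,
    Module.finrank_tensorProduct]
  · congr 1
    exact LinearEquiv.finrank_map_eq (MulOpposite.opLinearEquiv K : A ≃ₗ[K] Aᵐᵒᵖ) (F i)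
  · exact TensorProduct.map_injective_of_flat_flat _ _ (Submodule.subtype_injective _)
      (Submodule.subtype_injective _)

theorem finrank_baseChange_submodule (L : Type*) [Field L] [Algebra K L] (p : Submodule K A) :
    Module.finrank L (p.baseChange L) = Module.finrank K p := by
  rw [← (Submodule.toBaseChange.toLinearEquiv L p).finrank_eq, Module.finrank_baseChange]

theorem baseChange_mul_le (L : Type*) [Field L] [Algebra K L] {p q r : Submodule K A}
    (h : p * q ≤ r) : p.baseChange L * q.baseChange L ≤ r.baseChange L := by
  rw [Submodule.baseChange_eq_span, Submodule.baseChange_eq_span, Submodule.span_mul_span,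
    Submodule.span_le]
  rintro _ ⟨_, ⟨a, ha, rfl⟩, _, ⟨b, hb, rfl⟩, rfl⟩
  simp only [TensorProduct.mk_apply, Algebra.TensorProduct.tmul_mul_tmul, one_mul]
  exact Submodule.tmul_mem_baseChange_of_mem 1 (h (Submodule.mul_mem_mul ha hb))

end BoxFiltration

/-! ### Sequences of operators as a module over `K(s) ⊗ (D ⊗ Dᵒᵖ)` -/

section SeqModule

variable (K D : Type*) [Field K] [Ring D] [Algebra K D]

/-- Sequences in `D`, on which `K[X]` acts by `(p • x) n = p(n) • x n`. -/
def OpSeq (_ D : Type*) : Type _ := ℕ → D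

instance : AddCommGroup (OpSeq K D) := inferInstanceAs (AddCommGroup (ℕ → D))

instance : Module K (OpSeq K D) := inferInstanceAs (Module K (ℕ → D))

instance : Module K[X] (OpSeq K D) :=
  letI : Module (ℕ → K) (ℕ → D) := inferInstance
  Module.compHom (ℕ → D) (RingHom.pi fun n : ℕ => Polynomial.evalRingHom (n : K))

variable {K D}

omit [Field K] [Ring D] [Algebra K D] in
@[ext] theorem OpSeq.ext {x y : OpSeq K D} (h : ∀ n, x n = y n) : x = y := funext h

omit [Field K] [Algebra K D] in
@[simp] theorem OpSeq.add_apply (x y : OpSeq K D) (n : ℕ) : (x + y) n = x n + y n := rfl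

omit [Field K] [Algebra K D] in
@[simp] theorem OpSeq.zero_apply (n : ℕ) : (0 : OpSeq K D) n = 0 := rfl

@[simp] theorem OpSeq.smul_apply (c : K) (x : OpSeq K D) (n : ℕ) : (c • x) n = c • x n := rfl

@[simp] theorem OpSeq.poly_smul_apply (p : K[X]) (x : OpSeq K D) (n : ℕ) :
    (p • x) n = p.eval (n : K) • x n := rfl

omit [Field K] [Algebra K D] in
@[simp] theorem OpSeq.sum_apply {ι : Type*} (s : Finset ι) (x : ι → OpSeq K D) (n : ℕ) :
    (∑ i ∈ s, x i) n = ∑ i ∈ s, x i n := Finset.sum_apply (M := fun _ => D) n s x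

instance : IsScalarTower K K[X] (OpSeq K D) :=
  ⟨fun c p x => OpSeq.ext fun n => by simp [mul_smul]⟩

instance : SMulCommClass K[X] K (OpSeq K D) :=
  ⟨fun p c x => OpSeq.ext fun n => smul_comm (p.eval (n : K)) c (x n)⟩

variable (K D)

/-- Termwise left multiplication. -/
def OpSeq.mulLeft : D →ₐ[K] Module.End K[X] (OpSeq K D) where
  toFun a :=
    { toFun := fun x n => a * x n
      map_add' := fun _ _ => OpSeq.ext fun _ => mul_add _ _ _
      map_smul' := fun _ _ => OpSeq.ext fun _ => mul_smul_comm _ _ _ }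
  map_one' := LinearMap.ext fun _ => OpSeq.ext fun _ => one_mul _
  map_mul' _ _ := LinearMap.ext fun _ => OpSeq.ext fun _ => mul_assoc _ _ _
  map_zero' := LinearMap.ext fun _ => OpSeq.ext fun _ => zero_mul _
  map_add' _ _ := LinearMap.ext fun _ => OpSeq.ext fun _ => add_mul _ _ _
  commutes' c := LinearMap.ext fun x => OpSeq.ext fun n => (Algebra.smul_def c (x n)).symm

/-- Termwise right multiplication. -/
def OpSeq.mulRight : Dᵐᵒᵖ →ₐ[K] Module.End K[X] (OpSeq K D) where
  toFun a :=
    { toFun := fun x n => x n * a.unop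
      map_add' := fun _ _ => OpSeq.ext fun _ => add_mul _ _ _
      map_smul' := fun _ _ => OpSeq.ext fun _ => smul_mul_assoc _ _ _ }
  map_one' := LinearMap.ext fun _ => OpSeq.ext fun _ => mul_one _
  map_mul' _ _ := LinearMap.ext fun _ => OpSeq.ext fun _ => (mul_assoc _ _ _).symm
  map_zero' := LinearMap.ext fun _ => OpSeq.ext fun _ => mul_zero _
  map_add' _ _ := LinearMap.ext fun _ => OpSeq.ext fun _ => mul_add _ _ _
  commutes' c := LinearMap.ext fun x => OpSeq.ext fun n =>
    ((Algebra.smul_def c (x n)).trans (Algebra.commutes c (x n))).symm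

theorem OpSeq.commute_mulLeft_mulRight (a : D) (b : Dᵐᵒᵖ) :
    Commute (OpSeq.mulLeft K D a) (OpSeq.mulRight K D b) :=
  LinearMap.ext fun x => OpSeq.ext fun n => (mul_assoc a (x n) b.unop).symm

/-- The action of `D ⊗ Dᵒᵖ` on sequences by termwise multiplication from both sides. -/
def OpSeq.sandwich : D ⊗[K] Dᵐᵒᵖ →ₐ[K] Module.End K[X] (OpSeq K D) :=
  Algebra.TensorProduct.lift (OpSeq.mulLeft K D) (OpSeq.mulRight K D)
    (OpSeq.commute_mulLeft_mulRight K D)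

variable {K D} in
theorem OpSeq.sandwich_tmul_apply (a : D) (b : Dᵐᵒᵖ) (x : OpSeq K D) (n : ℕ) :
    OpSeq.sandwich K D (a ⊗ₜ b) x n = a * x n * b.unop := by
  rw [OpSeq.sandwich, Algebra.TensorProduct.lift_tmul, mul_assoc]
  rfl

variable (L : Type*) [Field L] [Algebra K L] [Algebra K[X] L] [IsScalarTower K K[X] L]

/-- The extension of scalars of the module of sequences to the field of rational functions. -/
def SeqModule (K D L : Type*) [Field K] [Ring D] [Algebra K D] [Field L]
    [Algebra K[X] L] : Type _ :=
  L ⊗[K[X]] OpSeq K D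

instance : AddCommGroup (SeqModule K D L) :=
  inferInstanceAs (AddCommGroup (L ⊗[K[X]] OpSeq K D))

instance : Module L (SeqModule K D L) :=
  inferInstanceAs (Module L (L ⊗[K[X]] OpSeq K D))

instance : Module K[X] (SeqModule K D L) :=
  inferInstanceAs (Module K[X] (L ⊗[K[X]] OpSeq K D))

instance : IsScalarTower K[X] L (SeqModule K D L) :=
  inferInstanceAs
    (IsScalarTower K[X] L (L ⊗[K[X]] OpSeq K D))

instance : Module K (SeqModule K D L) :=
  inferInstanceAs (Module K (L ⊗[K[X]] OpSeq K D))

instance : IsScalarTower K L (SeqModule K D L) :=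
  inferInstanceAs (IsScalarTower K L (L ⊗[K[X]] OpSeq K D))

instance : IsScalarTower K K[X] (SeqModule K D L) :=
  IsScalarTower.of_algebraMap_smul fun c x => by
    rw [← algebraMap_smul L (algebraMap K K[X] c) x, ← IsScalarTower.algebraMap_apply,
      algebraMap_smul]

/-- The class of a sequence. -/
def SeqModule.mk : OpSeq K D →ₗ[K[X]] SeqModule K D L :=
  TensorProduct.mk K[X] L (OpSeq K D) 1

instance [IsFractionRing K[X] L] : IsLocalizedModule (nonZeroDivisors K[X]) (SeqModule.mk K D L) :=
  inferInstanceAs (IsLocalizedModule (nonZeroDivisors K[X])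
    (TensorProduct.mk K[X] L (OpSeq K D) 1))

/-- The base change of an endomorphism of the module of sequences. -/
def SeqModule.endHom : Module.End K[X] (OpSeq K D) →ₐ[K] Module.End L (SeqModule K D L) where
  toFun φ := LinearMap.baseChange L φ
  map_one' := LinearMap.baseChange_id
  map_mul' φ ψ := LinearMap.baseChange_mul φ ψ
  map_zero' := LinearMap.baseChange_zero
  map_add' φ ψ := LinearMap.baseChange_add φ ψ
  commutes' c := by
    refine LinearMap.ext fun x => ?_
    change LinearMap.baseChange L (algebraMap K (Module.End K[X] (OpSeq K D)) c) x = c • x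
    induction x using TensorProduct.induction_on with
    | zero => rw [map_zero, smul_zero]
    | add x y hx hy => rw [map_add, smul_add, hx, hy]
    | tmul l x =>
      rw [LinearMap.baseChange_tmul, Module.algebraMap_end_apply,
        ← algebraMap_smul K[X] c x, TensorProduct.tmul_smul, algebraMap_smul]

theorem SeqModule.commute_ofId (c : L) (y : D ⊗[K] Dᵐᵒᵖ) :
    Commute (Algebra.ofId L (Module.End L (SeqModule K D L)) c)
      (((SeqModule.endHom K D L).comp (OpSeq.sandwich K D)) y) :=
  Algebra.commute_algebraMap_left c _

/-- The action of `D ⊗ Dᵒᵖ`, with scalars extended to the field of rational functions. -/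
def SeqModule.sandwich : L ⊗[K] (D ⊗[K] Dᵐᵒᵖ) →ₐ[L] Module.End L (SeqModule K D L) :=
  Algebra.TensorProduct.lift (Algebra.ofId _ _)
    ((SeqModule.endHom K D L).comp (OpSeq.sandwich K D))
    (SeqModule.commute_ofId K D L)

instance : Module (L ⊗[K] (D ⊗[K] Dᵐᵒᵖ)) (SeqModule K D L) :=
  Module.compHom _ (SeqModule.sandwich K D L).toRingHom

instance : IsScalarTower L (L ⊗[K] (D ⊗[K] Dᵐᵒᵖ))
    (SeqModule K D L) :=
  IsScalarTower.of_algebraMap_smul (A := L ⊗[K] (D ⊗[K] Dᵐᵒᵖ)) fun c x =>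
    congrArg (fun φ : Module.End L (SeqModule K D L) => φ x)
      ((SeqModule.sandwich K D L).commutes c)

variable {K D}

theorem SeqModule.mul_smul_eq (a b : L ⊗[K] (D ⊗[K] Dᵐᵒᵖ)) (x : SeqModule K D L) :
    (a * b) • x = a • b • x :=
  LinearMap.congr_fun (map_mul (SeqModule.sandwich K D L) a b) x

theorem SeqModule.tmul_smul_mk (c : L) (y : D ⊗[K] Dᵐᵒᵖ) (x : OpSeq K D) :
    (c ⊗ₜ[K] y) • SeqModule.mk K D L x = c • SeqModule.mk K D L (OpSeq.sandwich K D y x) := by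
  have h : SeqModule.sandwich K D L (c ⊗ₜ[K] y) (SeqModule.mk K D L x) =
      c • SeqModule.mk K D L (OpSeq.sandwich K D y x) := by
    rw [SeqModule.sandwich, Algebra.TensorProduct.lift_tmul]
    rfl
  exact h

omit [Algebra K L] [IsScalarTower K K[X] L] in
theorem SeqModule.mk_eq_mk_iff [IsFractionRing K[X] L] (x y : OpSeq K D) :
    SeqModule.mk K D L x = SeqModule.mk K D L y ↔
      ∃ p : K[X], p ≠ 0 ∧ ∀ n : ℕ, p.eval (n : K) • x n = p.eval (n : K) • y n := by
  rw [IsLocalizedModule.eq_iff_exists (nonZeroDivisors K[X]) (SeqModule.mk K D L)]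
  constructor
  · rintro ⟨c, hc⟩
    exact ⟨c, nonZeroDivisors.coe_ne_zero c, fun n => congrFun hc n⟩
  · rintro ⟨p, hp, h⟩
    exact ⟨⟨p, mem_nonZeroDivisors_of_ne_zero hp⟩, OpSeq.ext h⟩

-- The polynomial `∏ (X - k)` over `k < N` is invertible in `L` and kills the finitely many places
-- where the sequences may differ. Truncated exponents such as `n - i` are therefore harmless.
omit [Algebra K L] [IsScalarTower K K[X] L] in
theorem SeqModule.mk_eq_mk_of_eventually [IsFractionRing K[X] L] [CharZero K] {x y : OpSeq K D} {N : ℕ}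
    (h : ∀ n, N ≤ n → x n = y n) : SeqModule.mk K D L x = SeqModule.mk K D L y := by
  refine (SeqModule.mk_eq_mk_iff L x y).2 ⟨∏ k ∈ Finset.range N, (Polynomial.X - Polynomial.C (k : K)),
    Finset.prod_ne_zero_iff.2 fun k _ => Polynomial.X_sub_C_ne_zero _, fun n => ?_⟩
  rcases lt_or_ge n N with hn | hn
  · rw [Polynomial.eval_prod, Finset.prod_eq_zero (Finset.mem_range.2 hn) (by simp), zero_smul,
      zero_smul]
  · rw [h n hn]

end SeqModule

/-! ### Consequences of positive finite multiplicity -/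

section Growth

variable {K M : Type*} [Field K] [AddCommGroup M] [Module K M] {F : ℕ → Submodule K M}

theorem filtRank_eq_finrank {n : ℕ} [FiniteDimensional K (F n)] :
    filtRank F n = (Module.finrank K (F n) : ℝ≥0∞) := by
  rw [filtRank, ← Module.finrank_eq_rank, map_natCast]
  rfl

theorem finiteDimensional_of_filtRank_lt_top {n : ℕ} (h : filtRank F n < ⊤) :
    FiniteDimensional K (F n) := by
  rw [filtRank, ENat.toENNReal_lt_top, Cardinal.toENat_lt_top] at h
  exact Module.rank_lt_aleph0_iff.1 h

variable {k : ℕ} (hdim : filtDim F = k) (hfin : filtMult F < ⊤)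
include hdim hfin

theorem exists_filtRank_le : ∃ c : ℝ≥0, ∀ᶠ n : ℕ in Filter.atTop,
    filtRank F n ≤ c * (n : ℝ≥0∞) ^ k := by
  obtain ⟨c, hc, hc'⟩ := exists_between hfin
  lift c to ℝ≥0 using hc'.ne
  refine ⟨c, ?_⟩
  rw [filtMult, hdim, ENNReal.toReal_natCast] at hc
  filter_upwards [Filter.eventually_lt_of_limsup_lt hc, Filter.eventually_gt_atTop 0] with n hn hn0
  rw [ENNReal.rpow_natCast] at hn
  exact (ENNReal.div_le_iff (pow_ne_zero _ (by exact_mod_cast hn0.ne'))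
    (ENNReal.pow_ne_top (ENNReal.natCast_ne_top n))).1 hn.le

theorem finiteDimensional_of_filtMult_lt_top (hF : Monotone F) (n : ℕ) :
    FiniteDimensional K (F n) := by
  obtain ⟨c, hc⟩ := exists_filtRank_le hdim hfin
  obtain ⟨m, hm, hnm⟩ := (hc.and (Filter.eventually_ge_atTop n)).exists
  have := finiteDimensional_of_filtRank_lt_top (hm.trans_lt
    (ENNReal.mul_lt_top ENNReal.coe_lt_top (ENNReal.pow_lt_top (ENNReal.natCast_lt_top m))))
  exact Submodule.finiteDimensional_of_le (hF hnm)

/-- A filtration of polynomial growth with positive and finite multiplicity grows by a bounded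
factor, infinitely often, when the index is stretched by a constant. -/
theorem exists_finrank_lt_mul_finrank (hF : Monotone F) (hpos : 0 < filtMult F) (s : ℕ) :
    ∃ ℓ : ℕ, ∀ i₀ : ℕ, ∃ n : ℕ,
      Module.finrank K (F (s * n + i₀)) < ℓ * Module.finrank K (F n) := by
  have hfd := finiteDimensional_of_filtMult_lt_top hdim hfin hF
  obtain ⟨c', hc'⟩ := exists_filtRank_le hdim hfin
  obtain ⟨c, hc0, hc⟩ := exists_between hpos
  lift c to ℝ≥0 using (hc.trans hfin).ne
  rw [filtMult, hdim, ENNReal.toReal_natCast] at hc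
  have hfreq := Filter.frequently_lt_of_lt_limsup (by isBoundedDefault) hc
  have hc0' : 0 < c := by exact_mod_cast hc0
  -- Eventually `dim F n ≤ c' n^k`, and infinitely often `dim F n > c n^k`. For `n ≥ i₀` the offset
  -- is absorbed by `s * n + i₀ ≤ (s + 1) * n`, so `ℓ` does not depend on `i₀`.
  obtain ⟨ℓ, hℓ⟩ := exists_nat_gt (c' * (s + 1) ^ k / c)
  rw [div_lt_iff₀ hc0'] at hℓ
  refine ⟨ℓ, fun i₀ => ?_⟩
  obtain ⟨N, hN⟩ := Filter.eventually_atTop.1 hc'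
  obtain ⟨n, hn, hnN, hni, hn0⟩ := (hfreq.and_eventually ((Filter.eventually_ge_atTop N).and
    ((Filter.eventually_ge_atTop i₀).and (Filter.eventually_gt_atTop 0)))).exists
  refine ⟨n, ?_⟩
  rw [ENNReal.rpow_natCast, ENNReal.lt_div_iff_mul_lt
    (Or.inl (pow_ne_zero _ (by exact_mod_cast hn0.ne')))
    (Or.inl (ENNReal.pow_ne_top (ENNReal.natCast_ne_top n))), filtRank_eq_finrank] at hn
  have hup := hN ((s + 1) * n) (by nlinarith)
  rw [filtRank_eq_finrank] at hup
  have hle : Module.finrank K (F (s * n + i₀)) ≤ Module.finrank K (F ((s + 1) * n)) :=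
    Submodule.finrank_mono (hF (by rw [add_mul, one_mul]; omega))
  have hn' : c * (n : ℝ≥0) ^ k < (Module.finrank K (F n) : ℝ≥0) := by exact_mod_cast hn
  have hup' : (Module.finrank K (F ((s + 1) * n)) : ℝ≥0) ≤ c' * (((s + 1) * n : ℕ) : ℝ≥0) ^ k := by
    exact_mod_cast hup
  have : (Module.finrank K (F ((s + 1) * n)) : ℝ≥0) < ℓ * (Module.finrank K (F n) : ℝ≥0) := by
    calc (Module.finrank K (F ((s + 1) * n)) : ℝ≥0) ≤ c' * (s + 1) ^ k * n ^ k := by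
          rw [mul_assoc, ← mul_pow]; exact_mod_cast hup'
      _ < ℓ * c * n ^ k := by
          have : (0 : ℝ≥0) < n ^ k := by positivity
          exact mul_lt_mul_of_pos_right hℓ this
      _ ≤ ℓ * (Module.finrank K (F n) : ℝ≥0) := by
          rw [mul_assoc]; exact mul_le_mul_of_nonneg_left hn'.le (by positivity)
  exact hle.trans_lt (by exact_mod_cast this)

end Growth

/-! ### The chain of bimodules generated by powers -/

section Chain

variable {K D : Type*} [Field K] [CharZero K] [Ring D] [Algebra K D] {F : ℕ → Submodule K D}

/-- The sequence of powers `n ↦ g ^ (n + j)`. -/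
def powSeq (K : Type*) {D : Type*} [Ring D] (g : D) (j : ℕ) : OpSeq K D := fun n => g ^ (n + j)

variable (L : Type*) [Field L] [Algebra K L] [Algebra K[X] L] [IsScalarTower K K[X] L]
  [IsFractionRing K[X] L]

/-- If powers of `g` can be moved to the left of the operators, then the filtration of the bimodule
generated by `g ^ s` grows at most like the one of `D`. -/
theorem finrank_map_toSpanSingleton_le (hfin : ∀ i, FiniteDimensional K (F i))
    (hmul : ∀ i j, F i * F j ≤ F (i + j)) {g : D} {e : ℕ}
    (hmove : ∀ i, ∀ a ∈ F i, ∃ (p : ℕ → K[X]) (γ : ℕ → D), (∀ k ≤ i, γ k ∈ F (i + i * e)) ∧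
      ∀ n, i ≤ n → a * g ^ n =
        ∑ k ∈ Finset.range (i + 1), (p k).eval (n : K) • (g ^ (n - i) * γ k)) (i : ℕ) :
    Module.finrank L (((boxFiltration F i).baseChange L).map
      ((LinearMap.toSpanSingleton (L ⊗[K] (D ⊗[K] Dᵐᵒᵖ)) (SeqModule K D L)
        (SeqModule.mk K D L (powSeq K g 0))).restrictScalars L)) ≤
      Module.finrank K (F ((2 + e) * i)) := by
  -- The claim is that the filtered piece lies in the `L`-span of the sequences `n ↦ g^(n-i) γ`,
  -- where `γ` runs over one term of `F`. The subtraction is truncated, so equalities are used only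
  -- for `n ≥ i`.
  let T₀ : D →ₗ[K] OpSeq K D :=
    { toFun := fun γ n => g ^ (n - i) * γ
      map_add' := fun _ _ => OpSeq.ext fun _ => mul_add _ _ _
      map_smul' := fun _ _ => OpSeq.ext fun _ => mul_smul_comm _ _ _ }
  let T : D →ₗ[K] SeqModule K D L := (SeqModule.mk K D L).restrictScalars K ∘ₗ T₀
  have := hfin ((2 + e) * i)
  have hfinL : FiniteDimensional L ((F ((2 + e) * i)).baseChange L) :=
    Module.Finite.equiv (Submodule.toBaseChange.toLinearEquiv L (F ((2 + e) * i)))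
  have hT : ∀ γ ∈ F ((2 + e) * i),
      T γ ∈ ((F ((2 + e) * i)).baseChange L).map (T.liftBaseChange L) := fun γ hγ =>
    ⟨1 ⊗ₜ γ, Submodule.tmul_mem_baseChange_of_mem 1 hγ, by simp⟩
  rw [← finrank_baseChange_submodule L (F ((2 + e) * i))]
  refine (Submodule.finrank_mono (t := ((F ((2 + e) * i)).baseChange L).map (T.liftBaseChange L))
    ?_).trans (Submodule.finrank_map_le _ _)
  rw [boxFiltration_eq_span, Submodule.baseChange_span, Submodule.map_span_le]
  rintro _ ⟨_, ⟨a, ha, b, hb, rfl⟩, rfl⟩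
  obtain ⟨p, γ, hγ, hmv⟩ := hmove i a ha
  have key : (1 ⊗ₜ[K] (a ⊗ₜ[K] MulOpposite.op b) : L ⊗[K] (D ⊗[K] Dᵐᵒᵖ)) •
      SeqModule.mk K D L (powSeq K g 0) =
      ∑ k ∈ Finset.range (i + 1), algebraMap K[X] L (p k) • T (γ k * b) := by
    rw [SeqModule.tmul_smul_mk, one_smul]
    have h2 : ∑ k ∈ Finset.range (i + 1), algebraMap K[X] L (p k) • T (γ k * b) =
        SeqModule.mk K D L (∑ k ∈ Finset.range (i + 1),
          p k • T₀ (γ k * b)) := by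
      rw [map_sum]
      refine Finset.sum_congr rfl fun k _ => ?_
      rw [algebraMap_smul, map_smul]
      rfl
    rw [h2]
    refine SeqModule.mk_eq_mk_of_eventually L (N := i) fun n hn => ?_
    rw [OpSeq.sandwich_tmul_apply, OpSeq.sum_apply]
    simp only [OpSeq.poly_smul_apply, powSeq, add_zero, MulOpposite.unop_op]
    rw [hmv n hn, Finset.sum_mul]
    refine Finset.sum_congr rfl fun k _ => ?_
    rw [smul_mul_assoc, mul_assoc]
    rfl
  refine Set.mem_of_eq_of_mem key ?_
  refine Submodule.sum_mem _ fun k hk => Submodule.smul_mem _ _ (hT _ ?_)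
  have h3 := hmul _ _ (Submodule.mul_mem_mul (hγ k (by simp at hk; omega)) hb)
  rwa [show i + i * e + i = (2 + e) * i by ring] at h3

/-- The descending chain of bimodules generated by `g ^ (s + j)` is not strictly descending. -/
theorem exists_mk_powSeq_mem_span (hF : Monotone F) (hfin : ∀ i, FiniteDimensional K (F i))
    (h_one : ∀ i, 1 ∈ F i) (hmul : ∀ i j, F i * F j ≤ F (i + j))
    (hgrowth : ∀ s : ℕ, ∃ ℓ : ℕ, ∀ i₀ : ℕ, ∃ n : ℕ,
      Module.finrank K (F (s * n + i₀)) < ℓ * Module.finrank K (F n))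
    (hsimple : IsLinearlySimple (boxFiltration F)) {g : D} {e : ℕ} (hg : ∀ j, g ^ j ∈ F (j * e))
    (hmove : ∀ i, ∀ a ∈ F i, ∃ (p : ℕ → K[X]) (γ : ℕ → D), (∀ k ≤ i, γ k ∈ F (i + i * e)) ∧
      ∀ n, i ≤ n → a * g ^ n =
        ∑ k ∈ Finset.range (i + 1), (p k).eval (n : K) • (g ^ (n - i) * γ k)) :
    ∃ j, SeqModule.mk K D L (powSeq K g j) ∈
      Submodule.span (L ⊗[K] (D ⊗[K] Dᵐᵒᵖ)) {SeqModule.mk K D L (powSeq K g (j + 1))} := by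
  by_contra! hno
  have hboxmono : Monotone (boxFiltration F) := fun i j hij =>
    Submodule.map₂_le_map₂ (hF hij) (Submodule.map_mono (hF hij))
  have hboxfin := finite_boxFiltration hfin
  obtain ⟨C, hC⟩ := hsimple.baseChange L hboxfin (fun i => one_mem_boxFiltration (h_one i))
    (boxFiltration_mul_le hmul)
  set u : ℕ → SeqModule K D L := fun j => SeqModule.mk K D L (powSeq K g j) with hu
  have hshift : ∀ i j : ℕ, u (i + j) =
      ((1 : L) ⊗ₜ[K] ((g ^ j : D) ⊗ₜ[K] MulOpposite.op (1 : D)) : L ⊗[K] (D ⊗[K] Dᵐᵒᵖ)) • u i := by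
    intro i j
    rw [hu]
    dsimp only
    rw [SeqModule.tmul_smul_mk, one_smul]
    congr 1
    refine OpSeq.ext fun n => ?_
    rw [OpSeq.sandwich_tmul_apply, MulOpposite.unop_op, mul_one]
    simp only [powSeq, ← pow_add]
    congr 1
    ring
  set U : ℕ → Submodule (L ⊗[K] (D ⊗[K] Dᵐᵒᵖ)) (SeqModule K D L) :=
    fun j => Submodule.span _ {u j} with hU
  have hUanti : Antitone U := antitone_nat_of_succ_le fun j => by
    rw [hU]
    dsimp only
    rw [Submodule.span_singleton_le_iff_mem, hshift j 1]
    exact Submodule.smul_mem _ _ (Submodule.mem_span_singleton_self _)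
  set G : ℕ → Submodule L (SeqModule K D L) := fun i => ((boxFiltration F i).baseChange L).map
      ((LinearMap.toSpanSingleton (L ⊗[K] (D ⊗[K] Dᵐᵒᵖ)) (SeqModule K D L) (u 0)).restrictScalars L)
    with hG
  have hGmono : Monotone G := fun i j hij =>
    Submodule.map_mono (Submodule.baseChange_mono _ (hboxmono hij))
  have hGfin : ∀ i, FiniteDimensional L (G i) := fun i => by
    have := hboxfin i
    have : FiniteDimensional L ((boxFiltration F i).baseChange L) :=
      Module.Finite.equiv (Submodule.toBaseChange.toLinearEquiv L (boxFiltration F i))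
    infer_instance
  have hFG : ∀ i j, ∀ a ∈ (boxFiltration F i).baseChange L, ∀ x ∈ G j, a • x ∈ G (i + j) := by
    rintro i j a ha _ ⟨b, hb, rfl⟩
    refine ⟨a * b, baseChange_mul_le L (boxFiltration_mul_le hmul i j)
      (Submodule.mul_mem_mul ha hb), ?_⟩
    rw [LinearMap.coe_restrictScalars, LinearMap.toSpanSingleton_apply,
      LinearMap.toSpanSingleton_apply]
    exact SeqModule.mul_smul_eq L a b (u 0)
  -- The chain bound lives in index `n + (C * n + ℓ * e)`, which the upper bound stretches by `2 +
  -- e`. The length `ℓ` is fixed by the slope alone; only then is the offset chosen, since placing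
  -- `u j` for all `j < ℓ` in one filtered piece costs `ℓ * e`.
  obtain ⟨ℓ, hℓ⟩ := hgrowth ((2 + e) * (C + 1))
  obtain ⟨n, hn⟩ := hℓ ((2 + e) * (ℓ * e))
  have huG : ∀ j < ℓ, u j ∈ G (ℓ * e) := fun j hj => by
    refine hGmono (Nat.mul_le_mul_right e hj.le) ?_
    refine ⟨(1 : L) ⊗ₜ[K] ((g ^ j : D) ⊗ₜ[K] MulOpposite.op (1 : D)),
      Submodule.tmul_mem_baseChange_of_mem 1
      (tmul_mem_boxFiltration (hg j) (h_one _)), ?_⟩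
    have := hshift 0 j
    rw [zero_add] at this
    exact this.symm
  have key := mul_le_finrank_of_strict_chain hC hGmono hGfin hFG hUanti (ℓ := ℓ)
    (fun j _ => Submodule.mem_span_singleton_self (u j)) (fun j _ => hno j) huG (n := n)
    (b := Module.finrank K (F n)) (by rw [finrank_baseChange_submodule, finrank_boxFiltration])
  have hle := finrank_map_toSpanSingleton_le L hfin hmul hmove (n + (C * n + ℓ * e))
  rw [show (2 + e) * (n + (C * n + ℓ * e)) = (2 + e) * (C + 1) * n + (2 + e) * (ℓ * e) by ring]
    at hle
  exact absurd (key.trans hle) (not_le.2 hn)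

omit [CharZero K] in
/-- Clearing denominators in an element of the bimodule generated by a sequence. -/
theorem exists_smul_eq_mk_mem_span (a : L ⊗[K] (D ⊗[K] Dᵐᵒᵖ)) (x : OpSeq K D) :
    ∃ q : K[X], q ≠ 0 ∧ ∃ z ∈ Submodule.span K[X]
      {z : OpSeq K D | ∃ α β : D, z = fun n => α * x n * β},
      q • (a • SeqModule.mk K D L x) = SeqModule.mk K D L z := by
  induction a using TensorProduct.induction_on with
  | zero => exact ⟨1, one_ne_zero, 0, Submodule.zero_mem _, by
    have h0 : SeqModule.sandwich K D L 0 (SeqModule.mk K D L x) = 0 := by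
      rw [map_zero, LinearMap.zero_apply]
    rw [map_zero, one_smul]
    exact h0⟩
  | add a b ha hb =>
    obtain ⟨q, hq, z, hz, h⟩ := ha
    obtain ⟨q', hq', z', hz', h'⟩ := hb
    refine ⟨q' * q, mul_ne_zero hq' hq, q' • z + q • z',
      Submodule.add_mem _ (Submodule.smul_mem _ _ hz) (Submodule.smul_mem _ _ hz'), ?_⟩
    refine (congrArg ((q' * q) • ·) (add_smul a b (SeqModule.mk K D L x))).trans ?_
    rw [smul_add, mul_smul, h, mul_comm, mul_smul, h', map_add, map_smul, map_smul]
  | tmul l y =>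
    -- For `l = c / q`, multiplication by `q` leaves the polynomial `c`, which acts on the sequence
    -- itself.
    obtain ⟨c, q, rfl⟩ := IsLocalization.exists_mk'_eq (nonZeroDivisors K[X]) l
    refine ⟨q, nonZeroDivisors.coe_ne_zero q, c • OpSeq.sandwich K D y x,
      Submodule.smul_mem _ _ ?_, ?_⟩
    · induction y using TensorProduct.induction_on with
      | zero => simp
      | add y y' h h' => rw [map_add, LinearMap.add_apply]; exact Submodule.add_mem _ h h'
      | tmul α β =>
        exact Submodule.subset_span ⟨α, β.unop, OpSeq.ext fun n =>
          OpSeq.sandwich_tmul_apply α β x n⟩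
    · rw [SeqModule.tmul_smul_mk, ← algebraMap_smul L (q : K[X]), smul_smul,
        IsLocalization.mk'_spec', algebraMap_smul, map_smul]

end Chain

/-! ### From the stable chain to a sandwich equation -/

section Main

variable {K R : Type*} [Field K] [CharZero K] [CommRing R] [Algebra K R]

/-- Characteristic zero makes the binomial coefficients of the commutator expansion polynomials in
`n` over `K`, hence scalars in `K(s)`. -/
theorem exists_eval_eq_choose (K : Type*) [Field K] [CharZero K] (k : ℕ) :
    ∃ p : K[X], ∀ n : ℕ, p.eval (n : K) = (n.choose k : K) :=
  ⟨Polynomial.C ((k.factorial : K)⁻¹) * descPochhammer K k, fun n => by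
    rw [Polynomial.eval_mul, Polynomial.eval_C, Nat.cast_choose_eq_descPochhammer_div,
      div_eq_inv_mul]⟩

theorem exists_mul_mulOp_pow_eq {𝒜 : ℕ → Submodule K R} [GradedAlgebra 𝒜] {w : ℤ}
    (hw : IsSlope 𝒜 w) (hw1 : 1 ≤ w) {f : R} {e : ℕ}
    (he : mulOp K f ∈ bernsteinFiltration 𝒜 w e) (i : ℕ) (a : diffOps K R)
    (ha : a ∈ bernsteinFiltration 𝒜 w i) :
    ∃ (p : ℕ → K[X]) (γ : ℕ → diffOps K R),
      (∀ k ≤ i, γ k ∈ bernsteinFiltration 𝒜 w (i + i * e)) ∧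
      ∀ n, i ≤ n → a * mulOp K f ^ n =
        ∑ k ∈ Finset.range (i + 1), (p k).eval (n : K) • (mulOp K f ^ (n - i) * γ k) := by
  have hw0 : 0 ≤ w := by omega
  choose p hp using exists_eval_eq_choose K
  refine ⟨p, fun k => mulOp K f ^ (i - k) * (adMul f ^ k) a, fun k hk => ?_, fun n hn => ?_⟩
  · have := bernsteinFiltration_mul_le hw0 _ _ (Submodule.mul_mem_mul
      (mulOp_pow_mem_bernsteinFiltration hw0 he (i - k))
      (adMul_pow_mem_bernsteinFiltration hw0 he k ha))
    rwa [show (i - k) * e + (i + k * e) = i + i * e by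
      obtain ⟨t, rfl⟩ := Nat.exists_eq_add_of_le hk
      rw [Nat.add_sub_cancel_left]; ring] at this
  · rw [mul_mulOp_pow_of_mem f hn (mem_diffOpOrder_of_mem_bernsteinFiltration hw hw1 ha)]
    refine Finset.sum_congr rfl fun k _ => ?_
    rw [hp, Nat.cast_smul_eq_nsmul, nsmul_eq_mul]

omit [CharZero K] in
/-- Elements of the bimodule generated by `f ^ (s + j)`, after the substitution of `s - j`
for `s`. -/
theorem exists_sum_eval_mul_mulOp_pow {f : R} {j : ℕ} {z : OpSeq K (diffOps K R)}
    (hz : z ∈ Submodule.span K[X] {z : OpSeq K (diffOps K R) |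
      ∃ α β : diffOps K R, z = fun n => α * powSeq K (mulOp K f) (j + 1) n * β}) :
    ∃ (m : ℕ) (α β : Fin m → (diffOps K R)[X]), ∀ n : ℕ, j ≤ n → z (n - j) =
      ∑ i, (α i).eval (n : diffOps K R) * mulOp K f ^ (n + 1) *
        (β i).eval (n : diffOps K R) := by
  induction hz using Submodule.span_induction with
  | mem z hz =>
    obtain ⟨α, β, rfl⟩ := hz
    refine ⟨1, fun _ => Polynomial.C α, fun _ => Polynomial.C β, fun n hn => ?_⟩
    simp only [Finset.univ_unique, Finset.sum_singleton, Polynomial.eval_C, powSeq]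
    rw [show n - j + (j + 1) = n + 1 by omega]
  | zero => exact ⟨0, Fin.elim0, Fin.elim0, fun n _ => by simp⟩
  | add x y _ _ hx hy =>
    obtain ⟨m, α, β, h⟩ := hx
    obtain ⟨m', α', β', h'⟩ := hy
    refine ⟨m + m', Fin.append α α', Fin.append β β', fun n hn => ?_⟩
    rw [Fin.sum_univ_add]
    simp only [Fin.append_left, Fin.append_right, OpSeq.add_apply, h n hn, h' n hn]
  | smul c x _ hx =>
    obtain ⟨m, α, β, h⟩ := hx
    refine ⟨m, fun i => (c.comp (Polynomial.X - Polynomial.C (j : K))).map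
      (algebraMap K (diffOps K R)) * α i, β, fun n hn => ?_⟩
    simp only [eval_map_mul, smul_mul_assoc, ← Finset.smul_sum, ← h n hn,
      OpSeq.poly_smul_apply, Polynomial.eval_comp, Polynomial.eval_sub, Polynomial.eval_X,
      Polynomial.eval_C, Nat.cast_sub hn]

omit [CharZero K] in
theorem exists_satisfiesSBS_of_mem_span {f : R} {j : ℕ}
    (h : SeqModule.mk K (diffOps K R) (FractionRing K[X]) (powSeq K (mulOp K f) j) ∈
      Submodule.span (FractionRing K[X] ⊗[K] (diffOps K R ⊗[K] (diffOps K R)ᵐᵒᵖ))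
        {SeqModule.mk K (diffOps K R) (FractionRing K[X]) (powSeq K (mulOp K f) (j + 1))}) :
    ∃ b : K[X], b ≠ 0 ∧ SatisfiesSBS f b := by
  obtain ⟨a, ha⟩ := Submodule.mem_span_singleton.1 h
  obtain ⟨q, hq, z, hz, hqz⟩ := exists_smul_eq_mk_mem_span (FractionRing K[X]) a
    (powSeq K (mulOp K f) (j + 1))
  rw [ha, ← map_smul, SeqModule.mk_eq_mk_iff] at hqz
  obtain ⟨p, hp, hpz⟩ := hqz
  obtain ⟨m, α, β, hαβ⟩ := exists_sum_eval_mul_mulOp_pow (Submodule.smul_mem _ p hz)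
  -- The shifted equation is known only for `n ≥ j`. The factor `π` makes both sides vanish for `n <
  -- j`, so that it holds for all `n`.
  set π : K[X] := ∏ k ∈ Finset.range j, (Polynomial.X - Polynomial.C (k : K)) with hπ
  refine ⟨π * (p * q).comp (Polynomial.X - Polynomial.C (j : K)), mul_ne_zero
    (Finset.prod_ne_zero_iff.2 fun k _ => Polynomial.X_sub_C_ne_zero _) ?_, m,
    fun i => π.map (algebraMap K (diffOps K R)) * α i, β, fun n => ?_⟩
  · intro h0
    -- Undoing the substitution shows that it does not turn the nonzero polynomial `p * q` into
    -- zero.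
    have h1 := congrArg (fun r => r.comp (Polynomial.X + Polynomial.C (j : K))) h0
    simp only [Polynomial.comp_assoc, Polynomial.sub_comp, Polynomial.X_comp, Polynomial.C_comp,
      add_sub_cancel_right, Polynomial.comp_X, Polynomial.zero_comp] at h1
    exact mul_ne_zero hp hq h1
  · simp only [eval_map_mul, smul_mul_assoc, ← Finset.smul_sum, Polynomial.eval_mul, mul_smul]
    rcases lt_or_ge n j with hn | hn
    · have : π.eval (n : K) = 0 := by
        rw [hπ, Polynomial.eval_prod]
        exact Finset.prod_eq_zero (Finset.mem_range.2 hn) (by simp)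
      rw [this, zero_smul, zero_smul]
    · have h1 := hpz (n - j)
      rw [← hαβ n hn, OpSeq.poly_smul_apply, ← h1, OpSeq.poly_smul_apply]
      simp only [powSeq, Polynomial.eval_comp, Polynomial.eval_sub, Polynomial.eval_X,
        Polynomial.eval_C, Nat.cast_sub hn, Polynomial.eval_mul, mul_smul, Nat.sub_add_cancel hn]

end Main

end SandwichBS

end

theorem mainTheorem4 {K : Type*} {R : Type*} [Field K] [CharZero K] [CommRing R] [IsDomain R]
    [Algebra K R] [Algebra.FiniteType K R]
    (𝒜 : ℕ → Submodule K R) [GradedAlgebra 𝒜]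
    (h_zero : 𝒜 0 = LinearMap.range (Algebra.linearMap K R))
    (w : ℤ) (hw : SandwichBS.IsSlope 𝒜 w)
    (d : ℕ) (hd : ringKrullDim R = d)
    (h_dim : SandwichBS.filtDim (SandwichBS.bernsteinFiltration 𝒜 w) = 2 * d)
    (h_mult_pos : 0 < SandwichBS.filtMult (SandwichBS.bernsteinFiltration 𝒜 w))
    (h_mult_fin : SandwichBS.filtMult (SandwichBS.bernsteinFiltration 𝒜 w) < ⊤)
    (h_simple : SandwichBS.IsLinearlySimple
      (SandwichBS.boxFiltration (SandwichBS.bernsteinFiltration 𝒜 w)))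
    (f : R) (hf : f ≠ 0) :
    SandwichBS.sbsPolynomial K f ≠ 0 := by
  rcases lt_or_ge w 1 with hw1 | hw1
  -- A slope `w ≤ 0` allows no generators, so `R` is the image of `K`, `f` is a unit and `b = 1`
  -- works.
  · have hempty : {x : R | ∃ j : ℕ, (j : ℤ) < w ∧ x ∈ 𝒜 j} = ∅ :=
      Set.eq_empty_of_forall_notMem fun x ⟨j, hj, _⟩ => by omega
    rw [SandwichBS.IsSlope, hempty, Algebra.adjoin_empty] at hw
    obtain ⟨c, rfl⟩ := Algebra.mem_bot.1 (hw ▸ Algebra.mem_top : f ∈ (⊥ : Subalgebra K R))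
    refine SandwichBS.sbsPolynomial_ne_zero one_ne_zero
      (SandwichBS.satisfiesSBS_one_of_isUnit (IsUnit.map (algebraMap K R) (Ne.isUnit ?_)))
    rintro rfl
    exact hf (map_zero _)
  · have hmono := SandwichBS.bernsteinFiltration_mono (K := K) (𝒜 := 𝒜) w
    have hdim : SandwichBS.filtDim (SandwichBS.bernsteinFiltration 𝒜 w) = (2 * d : ℕ) := by
      rw [h_dim]; push_cast; rfl
    obtain ⟨e, he⟩ := SandwichBS.exists_mulOp_mem_bernsteinFiltration (𝒜 := 𝒜) w f
    have hw0 : 0 ≤ w := by omega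
    obtain ⟨j, hj⟩ := SandwichBS.exists_mk_powSeq_mem_span (FractionRing (Polynomial K)) hmono
      (SandwichBS.finiteDimensional_of_filtMult_lt_top hdim h_mult_fin hmono)
      (SandwichBS.one_mem_bernsteinFiltration w) (SandwichBS.bernsteinFiltration_mul_le hw0)
      (SandwichBS.exists_finrank_lt_mul_finrank hdim h_mult_fin hmono h_mult_pos) h_simple
      (SandwichBS.mulOp_pow_mem_bernsteinFiltration hw0 he)
      (SandwichBS.exists_mul_mulOp_pow_eq hw hw1 he)
    obtain ⟨b, hb, hfb⟩ := SandwichBS.exists_satisfiesSBS_of_mem_span hj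
    exact SandwichBS.sbsPolynomial_ne_zero hb hfb
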